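/- Let $M^2$ be a smooth ($C^\infty$, Hausdorff) surface with a smooth foliation $\mathcal F$ by curves, let $N$ be a vector field on $M$ of class $C^2$, let $\psi\in C^3(\mathbb R)$, and let $g_t$ $(0\le t<\varepsilon)$ be a family of Riemannian metrics of class $C^2$ on $M$, continuously differentiable in $t$ (i.e. $t\mapsto g_t(u,v)$ is $C^1$ on $[0,\varepsilon)$ for all $x\in M$ and $u,v\in T_xM$). Assume that every $g_t$ is adapted to $(\mathcal F,N)$, that is, $g_t(N,N)=1$ and $g_t(N,T\mathcal F)=0$. Let $\nabla^t$ be the Levi-Civita connection of $g_t$, $\operatorname{div}_t Y=\operatorname{tr}(u\mapsto\nabla^t_uY)$ the divergence of $g_t$, $\hat g_t(u,v)=g_t(\hat u,\hat v)$, where $\hat u=u-g_t(u,N)N$ is the component of $u$ along $T\mathcal F$, and let $\lambda_t:M\to\mathbb R$ be the $g_t$-geodesic curvature of $\mathcal F$ with respect to $N$: the $T\mathcal F$-component of $-\nabla^t_uN$ is $\lambda_t u$ for all $u\in T\mathcal F$. Suppose that $g_t$ satisfies the flow equation $$\partial_t g_t=-N(\psi(\lambda_t))\,\hat g_t\qquad(0\le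 t<\varepsilon).$$ Then for all $t\in[0,\varepsilon)$ the Gaussian curvature $K_t$ of $g_t$ is given on $M$ by $$K_t=\operatorname{div}_t\Big(\exp\Big(\int_0^t N(\psi(\lambda_\xi))\,d\xi\Big)\,\nabla^0_NN\Big)+N(\lambda_t)-\lambda_t^2 ,$$ where at each point the integrand is integrable in $\xi$ over $[0,t]$, and $\lambda_t$ and the vector field under the divergence are differentiable on $M$. -/

import Mathlib

open Set Bundle VectorField
open scoped Manifold ContDiff Topology

set_option linter.unusedSectionVars false

noncomputable section

namespace FoliatedSurface

section LeviCivita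

variable {E : Type*} [NormedAddCommGroup E] [NormedSpace ℝ E] [FiniteDimensional ℝ E]
  [CompleteSpace E] {H : Type*} [TopologicalSpace H] {I : ModelWithCorners ℝ E H}
  {M : Type*} [TopologicalSpace M] [ChartedSpace H M] [IsManifold I ∞ M]
  (g : ContMDiffRiemannianMetric I 2 E (TangentSpace I : M → Type _))

/-- The right-hand side of the Koszul formula for the Levi-Civita connection, at the point `x`. -/
def koszul (X Y Z : Π x : M, TangentSpace I x) (x : M) : ℝ :=
  d% (fun y ↦ g.inner y (Y y) (Z y)) x (X x) + d% (fun y ↦ g.inner y (X y) (Z y)) x (Y x)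
    - d% (fun y ↦ g.inner y (X y) (Y y)) x (Z x)
    + g.inner x (mlieBracket I X Y x) (Z x) - g.inner x (mlieBracket I X Z x) (Y x)
    - g.inner x (mlieBracket I Y Z x) (X x)

variable {X Y Z : Π x : M, TangentSpace I x} {x : M}

theorem mdiff_inner (hX : MDiffAt (T% X) x) (hY : MDiffAt (T% Y) x) :
    MDiffAt (fun y ↦ g.inner y (X y) (Y y)) x := by
  have h : MDifferentiableAt I (I.prod 𝓘(ℝ, ℝ))
      (fun m ↦ TotalSpace.mk' ℝ (E := Bundle.Trivial M ℝ) m (g.inner m (X m) (Y m))) x := by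
    apply MDifferentiableAt.clm_bundle_apply₂ (F₁ := E) (F₂ := E)
    · exact (g.contMDiff x).mdifferentiableAt (by norm_num)
    · exact hX
    · exact hY
  simp only [mdifferentiableAt_totalSpace] at h
  exact h.2

theorem koszul_tensorial_left (hY : MDiffAt (T% Y) x) (hZ : MDiffAt (T% Z) x) :
    TensorialAt I E (fun X ↦ koszul g X Y Z x) x where
  smul {f X} hf hX := by
    have h1 := mdiff_inner g hX hZ
    have h2 := mdiff_inner g hX hY
    simp [koszul, mvfderiv_fun_mul hf h1, mvfderiv_fun_mul hf h2, mlieBracket_smul_left hf hX]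
    ring
  add {X X'} hX hX' := by
    have h1 := mdiff_inner g hX hZ
    have h2 := mdiff_inner g hX hY
    have h1' := mdiff_inner g hX' hZ
    have h2' := mdiff_inner g hX' hY
    simp [koszul, mvfderiv_fun_add h1 h1', mvfderiv_fun_add h2 h2', mlieBracket_add_left hX hX']
    ring

theorem koszul_tensorial_right (hX : MDiffAt (T% X) x) (hY : MDiffAt (T% Y) x) :
    TensorialAt I E (fun Z ↦ koszul g X Y Z x) x where
  smul {f Z} hf hZ := by
    have h1 := mdiff_inner g hX hZ
    have h2 := mdiff_inner g hY hZ
    simp [koszul, mvfderiv_fun_mul hf h1, mvfderiv_fun_mul hf h2, mlieBracket_smul_right hf hZ]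
    rw [g.symm x (Z x) (Y x), g.symm x (Z x) (X x)]
    ring
  add {Z Z'} hZ hZ' := by
    have h1 := mdiff_inner g hX hZ
    have h2 := mdiff_inner g hY hZ
    have h1' := mdiff_inner g hX hZ'
    have h2' := mdiff_inner g hY hZ'
    simp [koszul, mvfderiv_fun_add h1 h1', mvfderiv_fun_add h2 h2', mlieBracket_add_right hZ hZ']
    ring

theorem koszul_add_middle {Y' : Π x : M, TangentSpace I x} (hX : MDiffAt (T% X) x)
    (hY : MDiffAt (T% Y) x) (hY' : MDiffAt (T% Y') x) (hZ : MDiffAt (T% Z) x) :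
    koszul g X (Y + Y') Z x = koszul g X Y Z x + koszul g X Y' Z x := by
  have h1 := mdiff_inner g hX hY
  have h2 := mdiff_inner g hY hZ
  have h1' := mdiff_inner g hX hY'
  have h2' := mdiff_inner g hY' hZ
  simp [koszul, mvfderiv_fun_add h1 h1', mvfderiv_fun_add h2 h2', mlieBracket_add_right hY hY',
    mlieBracket_add_left hY hY']
  ring

theorem koszul_smul_middle {f : M → ℝ} (hf : MDiffAt f x) (hX : MDiffAt (T% X) x)
    (hY : MDiffAt (T% Y) x) (hZ : MDiffAt (T% Z) x) :
    koszul g X (f • Y) Z x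
      = f x * koszul g X Y Z x + 2 * (d% f x (X x) * g.inner x (Y x) (Z x)) := by
  have h1 := mdiff_inner g hX hY
  have h2 := mdiff_inner g hY hZ
  simp [koszul, mvfderiv_fun_mul hf h1, mvfderiv_fun_mul hf h2, mlieBracket_smul_right hf hY,
    mlieBracket_smul_left hf hY]
  rw [g.symm x (Y x) (X x)]
  ring

/-- The musical isomorphism `v ↦ g(v, ·)`. -/
def flat (x : M) : TangentSpace I x ≃ₗ[ℝ] (TangentSpace I x →L[ℝ] ℝ) :=
  haveI : FiniteDimensional ℝ (TangentSpace I x) := inferInstanceAs (FiniteDimensional ℝ E)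
  haveI : T2Space (TangentSpace I x) := inferInstanceAs (T2Space E)
  haveI : FiniteDimensional ℝ (TangentSpace I x →L[ℝ] ℝ) :=
    inferInstanceAs (FiniteDimensional ℝ (E →L[ℝ] ℝ))
  LinearEquiv.ofBijective (g.inner x : TangentSpace I x →ₗ[ℝ] (TangentSpace I x →L[ℝ] ℝ)) <| by
    have hinj : Function.Injective
        (g.inner x : TangentSpace I x →ₗ[ℝ] (TangentSpace I x →L[ℝ] ℝ)) := by
      rw [injective_iff_map_eq_zero]
      intro v hv
      by_contra hne
      have h := g.pos x v hne
      have h0 : g.inner x v v = 0 := congrArg (fun φ : TangentSpace I x →L[ℝ] ℝ ↦ φ v) hv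
      exact h.ne' h0
    refine ⟨hinj, (LinearMap.injective_iff_surjective_of_finrank_eq_finrank ?_).1 hinj⟩
    rw [← LinearEquiv.finrank_eq (LinearMap.toContinuousLinearMap (𝕜 := ℝ)
      (E := TangentSpace I x) (F' := ℝ))]
    exact (Subspace.dual_finrank_eq (K := ℝ) (V := TangentSpace I x)).symm

open Classical in
/-- The Levi-Civita covariant derivative `u ↦ ∇_u Y` at `x`, obtained from the Koszul formula
`2 g(∇_X Y, Z) = koszul X Y Z` (and `0` if `Y` is not differentiable at `x`). -/
def leviCivitaFun (g : ContMDiffRiemannianMetric I 2 E (TangentSpace I : M → Type _)) (Y : Π x : M, TangentSpace I x) (x : M) :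
    TangentSpace I x →L[ℝ] TangentSpace I x :=
  haveI : FiniteDimensional ℝ (TangentSpace I x) := inferInstanceAs (FiniteDimensional ℝ E)
  haveI : T2Space (TangentSpace I x) := inferInstanceAs (T2Space E)
  if hY : MDiffAt (T% Y) x then
    LinearMap.toContinuousLinearMap
      ((flat g x).symm.toLinearMap ∘ₗ
        (((1 / 2 : ℝ) • TensorialAt.mkHom₂ (fun X Z ↦ koszul g X Y Z x) x
          (fun _ hZ ↦ koszul_tensorial_left g hY hZ)
          (fun _ hX ↦ koszul_tensorial_right g hX hY) :
            TangentSpace I x →L[ℝ] TangentSpace I x →L[ℝ] ℝ) :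
          TangentSpace I x →ₗ[ℝ] TangentSpace I x →L[ℝ] ℝ))
  else 0

theorem flat_apply (u v : TangentSpace I x) : flat g x u v = g.inner x u v := rfl

theorem inner_leviCivitaFun (hX : MDiffAt (T% X) x) (hY : MDiffAt (T% Y) x)
    (hZ : MDiffAt (T% Z) x) :
    2 * g.inner x (leviCivitaFun g Y x (X x)) (Z x) = koszul g X Y Z x := by
  rw [← flat_apply, leviCivitaFun, dif_pos hY]
  simp [TensorialAt.mkHom₂_apply (F := E) (F' := E) (I := I)
    (Φ := fun X Z ↦ koszul g X Y Z x) (fun _ hZ ↦ koszul_tensorial_left g hY hZ)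
          (fun _ hX ↦ koszul_tensorial_right g hX hY) hX hZ]

theorem leviCivitaFun_unique (hY : MDiffAt (T% Y) x) {L : TangentSpace I x →L[ℝ] TangentSpace I x}
    (h : ∀ X Z : Π x : M, TangentSpace I x, MDiffAt (T% X) x → MDiffAt (T% Z) x →
      2 * g.inner x (L (X x)) (Z x) = koszul g X Y Z x) :
    leviCivitaFun g Y x = L := by
  ext u
  apply (flat g x).injective
  ext w
  have hu := FiberBundle.mdifferentiableAt_extend (I := I) (F := E) (x := x) u
  have hw := FiberBundle.mdifferentiableAt_extend (I := I) (F := E) (x := x) w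
  have h1 := h _ _ hu hw
  have h2 := inner_leviCivitaFun g hu hY hw
  simp only [FiberBundle.extend_apply_self] at h1 h2
  rw [flat_apply, flat_apply]
  linarith

/-- The Levi-Civita connection of a Riemannian metric; `leviCivita g Y x u` is `∇_u Y`
for `u` tangent at `x`. -/
def leviCivita : CovariantDerivative I E (TangentSpace I : M → Type _) where
  toFun := leviCivitaFun g
  isCovariantDerivativeOnUniv :=
    { add := by
        intro Y Y' x hY hY' _
        refine leviCivitaFun_unique g (mdifferentiableAt_add_section hY hY') fun X Z hX hZ ↦ ?_
        rw [koszul_add_middle g hX hY hY' hZ, ← inner_leviCivitaFun g hX hY hZ,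
          ← inner_leviCivitaFun g hX hY' hZ]
        simp
        ring
      leibniz := by
        intro Y f x hY hf _
        refine leviCivitaFun_unique g (hf.smul_section hY) fun X Z hX hZ ↦ ?_
        rw [koszul_smul_middle g hf hX hY hZ, ← inner_leviCivitaFun g hX hY hZ]
        simp
        ring }

/-- The Koszul formula. -/
theorem inner_leviCivita (hX : MDiffAt (T% X) x) (hY : MDiffAt (T% Y) x)
    (hZ : MDiffAt (T% Z) x) :
    2 * g.inner x (leviCivita g Y x (X x)) (Z x) = koszul g X Y Z x :=
  inner_leviCivitaFun g hX hY hZ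

/-- The Levi-Civita connection is torsion-free. -/
theorem leviCivita_torsion (hX : MDiffAt (T% X) x) (hY : MDiffAt (T% Y) x) :
    leviCivita g Y x (X x) - leviCivita g X x (Y x) = mlieBracket I X Y x := by
  apply (flat g x).injective
  ext w
  have hw := FiberBundle.mdifferentiableAt_extend (I := I) (F := E) (x := x) w
  have h1 := inner_leviCivita g hX hY hw
  have h2 := inner_leviCivita g hY hX hw
  have h3 : (fun y ↦ g.inner y (X y) (Y y)) = fun y ↦ g.inner y (Y y) (X y) :=
    funext fun y ↦ g.symm y _ _
  simp only [koszul, FiberBundle.extend_apply_self, h3, mlieBracket_swap_apply (V := Y) (W := X),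
    map_neg, neg_apply] at h1 h2
  rw [map_sub, sub_apply, flat_apply, flat_apply, flat_apply]
  linarith

/-- The Levi-Civita connection is compatible with the metric. -/
theorem leviCivita_metric (hX : MDiffAt (T% X) x) (hY : MDiffAt (T% Y) x)
    (hZ : MDiffAt (T% Z) x) :
    d% (fun y ↦ g.inner y (Y y) (Z y)) x (X x)
      = g.inner x (leviCivita g Y x (X x)) (Z x) + g.inner x (Y x) (leviCivita g Z x (X x)) := by
  have h1 := inner_leviCivita g hX hY hZ
  have h2 := inner_leviCivita g hX hZ hY
  have h3 : (fun y ↦ g.inner y (Z y) (Y y)) = fun y ↦ g.inner y (Y y) (Z y) :=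
    funext fun y ↦ g.symm y _ _
  have h4 : (fun y ↦ g.inner y (Z y) (X y)) = fun y ↦ g.inner y (X y) (Z y) :=
    funext fun y ↦ g.symm y _ _
  simp only [koszul, h3, mlieBracket_swap_apply (V := Z) (W := Y),
    map_neg, neg_apply] at h1 h2
  rw [g.symm x (Y x)]
  linarith

/-- The curvature `R(X, Y)Z = ∇_X ∇_Y Z - ∇_Y ∇_X Z - ∇_[X,Y] Z` of a connection, at `x`. -/
def curvature (cov : CovariantDerivative I E (TangentSpace I : M → Type _))
    (X Y Z : Π x : M, TangentSpace I x) (x : M) : TangentSpace I x :=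
  cov (fun y ↦ cov Z y (Y y)) x (X x) - cov (fun y ↦ cov Z y (X y)) x (Y x)
    - cov Z x (mlieBracket I X Y x)

/-- The sectional curvature of the plane spanned by the linearly independent vectors `u`, `v`
tangent at `x`; it is computed on the vector fields that extend `u` and `v` with constant
coordinates in the preferred chart at `x`. -/
def sectionalCurvature (x : M) (u v : TangentSpace I x) : ℝ :=
  g.inner x (curvature (leviCivita g) (FiberBundle.extend E u) (FiberBundle.extend E v)
      (FiberBundle.extend E v) x) u
    / (g.inner x u u * g.inner x v v - g.inner x u v ^ 2)

/-- The divergence of a vector field: `div Y = tr (u ↦ ∇_u Y)`. -/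
def divergence (Y : Π x : M, TangentSpace I x) (x : M) : ℝ :=
  LinearMap.trace ℝ (TangentSpace I x) (leviCivita g Y x)

/-- The component of a tangent vector orthogonal to the `g`-unit vector field `N`. -/
def tangential (N : Π x : M, TangentSpace I x) (x : M) :
    TangentSpace I x →L[ℝ] TangentSpace I x :=
  ContinuousLinearMap.id ℝ (TangentSpace I x) - (g.inner x (N x)).smulRight (N x)

/-- The truncated metric `ĝ(u, v) = g(û, v̂)`, where `û` is the component of `u` tangent to the
leaves of a foliation with unit normal `N`. -/
def truncated (N : Π x : M, TangentSpace I x) (x : M) (u v : TangentSpace I x) : ℝ :=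
  g.inner x (tangential g N x u) (tangential g N x v)

/-- The Weingarten operator `A(u) = -(∇_u N)^⊤` for `u` tangent to the leaves, extended by
`A(N) = 0`. -/
def weingarten (N : Π x : M, TangentSpace I x) (x : M) :
    TangentSpace I x →L[ℝ] TangentSpace I x :=
  -(tangential g N x ∘L leviCivita g N x ∘L tangential g N x)

end LeviCivita
section Surface

variable {M : Type*} [TopologicalSpace M] [ChartedSpace (EuclideanSpace ℝ (Fin 2)) M]
  [IsManifold (𝓡 2) ∞ M]

variable (M) in
/-- Riemannian metrics of class `C^2` on the smooth surface `M`. -/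
abbrev Metric :=
  ContMDiffRiemannianMetric (𝓡 2) 2 (EuclideanSpace ℝ (Fin 2)) (TangentSpace (𝓡 2) : M → Type)

/-- The Gaussian curvature: the sectional curvature of the whole tangent plane, computed on the
coordinate frame at `x`. -/
def gaussianCurvature (g : Metric M) (x : M) : ℝ :=
  sectionalCurvature g x
    (show TangentSpace (𝓡 2) x from (EuclideanSpace.single 0 1 : EuclideanSpace ℝ (Fin 2)))
    (show TangentSpace (𝓡 2) x from (EuclideanSpace.single 1 1 : EuclideanSpace ℝ (Fin 2)))

variable (M) in
/-- A smooth foliation of the surface `M` by curves, given by an atlas of foliated charts. In such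
a chart the leaves are the horizontal lines, and the transition maps preserve, locally, the
horizontal lines. -/
structure Foliation where
  charts : Set (OpenPartialHomeomorph M (EuclideanSpace ℝ (Fin 2)))
  smooth : charts ⊆ IsManifold.maximalAtlas (𝓡 2) ∞ M
  cover : ∀ x : M, ∃ e ∈ charts, x ∈ e.source
  compatible : ∀ e ∈ charts, ∀ e' ∈ charts, ∀ a ∈ (e.symm.trans e').source,
    ∃ U ∈ 𝓝 a, ∀ b ∈ U, ∀ c ∈ U, b 1 = c 1 → e' (e.symm b) 1 = e' (e.symm c) 1

/-- A foliated chart around `x`. -/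
def Foliation.chart (F : Foliation M) (x : M) :
    OpenPartialHomeomorph M (EuclideanSpace ℝ (Fin 2)) :=
  (F.cover x).choose

/-- The tangent line at `x` of the leaf through `x`: the kernel of the differential of the
transverse coordinate of a foliated chart (by compatibility, of any foliated chart) around `x`. -/
def Foliation.tangent (F : Foliation M) (x : M) : Submodule ℝ (TangentSpace (𝓡 2) x) :=
  LinearMap.ker (mvfderiv (𝓡 2) (fun y ↦ F.chart x y 1) x : TangentSpace (𝓡 2) x →ₗ[ℝ] ℝ)

/-- The metric `g` is adapted to `(F, N)`: the vector field `N` is the `g`-unit normal of `F`. -/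
def IsAdapted (F : Foliation M) (N : Π x : M, TangentSpace (𝓡 2) x) (g : Metric M) : Prop :=
  ∀ x : M, g.inner x (N x) (N x) = 1 ∧ ∀ u ∈ F.tangent x, g.inner x (N x) u = 0

/-- The geodesic curvature `λ` of the leaves with respect to the unit normal `N`: the Weingarten
operator is multiplication by `λ` on the (one-dimensional) tangent lines of the leaves and
vanishes on `N`, so that `λ` is its trace. -/
def leafCurvature (N : Π x : M, TangentSpace (𝓡 2) x) (g : Metric M) (x : M) : ℝ :=
  LinearMap.trace ℝ (TangentSpace (𝓡 2) x) (weingarten g N x)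

/-- `A = λ · id` on the tangent lines of the leaves. -/
theorem weingarten_apply {F : Foliation M} {N : Π x : M, TangentSpace (𝓡 2) x} {g : Metric M}
    (h : IsAdapted F N g) (x : M) {u : TangentSpace (𝓡 2) x} (hu : u ∈ F.tangent x) :
    weingarten g N x u = leafCurvature N g x • u := by
  obtain ⟨h1, h2⟩ := h x
  have h2 := h2 u hu
  have : FiniteDimensional ℝ (TangentSpace (𝓡 2) x) :=
    inferInstanceAs (FiniteDimensional ℝ (EuclideanSpace ℝ (Fin 2)))
  have hfr : Module.finrank ℝ (TangentSpace (𝓡 2) x) = 2 :=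
    (finrank_euclideanSpace_fin (𝕜 := ℝ) (n := 2))
  rcases eq_or_ne u 0 with rfl | hu0
  · simp
  have hpos := g.pos x u hu0
  have hLN : weingarten g N x (N x) = 0 := by
    simp [weingarten, tangential, h1]
  have hNL : g.inner x (N x) (weingarten g N x u) = 0 := by
    simp [weingarten, tangential, h1]
  have hli : LinearIndependent ℝ ![N x, u] := by
    rw [LinearIndependent.pair_iff]
    intro a b hab
    have ha : a = 0 := by
      have := congrArg (fun w ↦ g.inner x (N x) w) hab
      simpa [h1, h2] using this
    subst ha
    simpa [hu0] using hab
  let B := basisOfLinearIndependentOfCardEqFinrank hli (by simp [hfr])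
  have hB0 : B 0 = N x := by simp [B]
  have hB1 : B 1 = u := by simp [B]
  have hexp := B.sum_repr (weingarten g N x u)
  rw [Fin.sum_univ_two, hB0, hB1] at hexp
  have h0 : B.repr (weingarten g N x u) 0 = 0 := by
    rw [← hexp] at hNL
    simpa [h1, h2] using hNL
  have htr : leafCurvature N g x = B.repr (weingarten g N x u) 1 := by
    rw [leafCurvature, LinearMap.trace_eq_matrix_trace ℝ B, Matrix.trace_fin_two,
      LinearMap.toMatrix_apply, LinearMap.toMatrix_apply, hB0, hB1]
    simp [hLN]
  rw [htr]
  rw [h0] at hexp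
  simpa using hexp.symm

/-- The derivative `N(f)` of a function along a vector field. -/
def along (N : Π x : M, TangentSpace (𝓡 2) x) (f : M → ℝ) (x : M) : ℝ :=
  mvfderiv (𝓡 2) f x (N x)

/-- The family `g t`, `0 ≤ t < ε`, of Riemannian metrics adapted to `(F, N)`, continuously
differentiable in `t`, is a solution of the flow `∂ₜ g = -N(ψ(λ)) ĝ`. -/
structure IsFlow (F : Foliation M) (N : Π x : M, TangentSpace (𝓡 2) x) (ψ : ℝ → ℝ) (ε : ℝ)
    (g : ℝ → Metric M) : Prop where
  adapted : ∀ t ∈ Ico 0 ε, IsAdapted F N (g t)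
  contDiffOn : ∀ (x : M) (u v : TangentSpace (𝓡 2) x),
    ContDiffOn ℝ 1 (fun t ↦ (g t).inner x u v) (Ico 0 ε)
  flow : ∀ t ∈ Ico 0 ε, ∀ (x : M) (u v : TangentSpace (𝓡 2) x),
    HasDerivWithinAt (fun s ↦ (g s).inner x u v)
      (-along N (fun y ↦ ψ (leafCurvature N (g t) y)) x * truncated (g t) N x u v) (Ico 0 ε) t

end Surface

end FoliatedSurface
end

/-! The theorem separates into an identity for a single metric and an evolution law for one vector
field.

For a fixed `C^2` metric with a `C^2` unit field `N`, complete `N` locally to an orthonormal frame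
`T, N` and put `α = g(∇_T T, N)`, `β = g(∇_N T, N)`. Then `∇_T N = -αT` and `∇_N N = -βT`, so `λ =
α`, `div(∇_N N) = -T(β) - β²` and `K = N(α) - T(β) - α² - β²`. Eliminating `β` gives `K = div(∇_N N)
+ N(λ) - λ²` (`gaussianCurvature_eq_divergence`).

Along the flow the covector `g_t(N, ·)` is constant, because `ĝ_t(N, ·) = 0` (`inner_normal_eq`). As
`N` is a unit field, the Koszul formula gives `g_t(∇_N N, Z) = N(g_t(N, Z)) - g_t(N, [N, Z])`, so
the covector dual to `∇^t_N N` is constant as well. The metric along the leaves, in contrast, is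
multiplied by `exp(-∫ N(ψ(λ)))` (`exp_integral_mul_truncated`). Since `∇_N N` is tangent to the
leaves, the vector itself is multiplied by the inverse factor (`exp_integral_smul_leviCivita`). The
field under the divergence is therefore exactly `∇^t_N N`, and the identity for `g_t` is the claim.

The curvature is defined on chart extensions of vectors, so its tensoriality has to be proved for
`C^2` fields and a `C^2` metric in order to compute it in the frame. -/

noncomputable section

namespace FoliatedSurface

/-! ### Regularity of inner products, Lie brackets and derivatives of functions -/

section General

variable {E : Type*} [NormedAddCommGroup E] [NormedSpace ℝ E] [FiniteDimensional ℝ E]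
  [CompleteSpace E] {H : Type*} [TopologicalSpace H] {I : ModelWithCorners ℝ E H}
  {M : Type*} [TopologicalSpace M] [ChartedSpace H M] [IsManifold I ∞ M]
  (g : ContMDiffRiemannianMetric I 2 E (TangentSpace I : M → Type _))
  {X Y T : Π x : M, TangentSpace I x} {x : M}

variable (I M) in
theorem isManifold_two : IsManifold I 2 M :=
  .of_le (n := ∞) (by norm_cast)

theorem contMDiffAt_inner {n : ℕ∞ω} (hn : n ≤ 2) (hX : CMDiffAt n (T% X) x)
    (hY : CMDiffAt n (T% Y) x) : CMDiffAt n (fun y ↦ g.inner y (X y) (Y y)) x := by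
  have h : ContMDiffAt I (I.prod 𝓘(ℝ, ℝ)) n
      (fun m ↦ TotalSpace.mk' ℝ (E := Bundle.Trivial M ℝ) m (g.inner m (X m) (Y m))) x := by
    apply ContMDiffAt.clm_bundle_apply₂ (F₁ := E) (F₂ := E)
    · exact (g.contMDiff x).of_le hn
    · exact hX
    · exact hY
  simp only [contMDiffAt_totalSpace] at h
  exact h.2

theorem inner_left_injective {u v : TangentSpace I x} (h : ∀ w, g.inner x u w = g.inner x v w) :
    u = v :=
  (flat g x).injective (ContinuousLinearMap.ext h)

theorem contMDiffAt_mlieBracket (hX : CMDiffAt 2 (T% X) x) (hY : CMDiffAt 2 (T% Y) x) :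
    CMDiffAt 1 (T% (mlieBracket I X Y)) x :=
  have : IsManifold I ((2 : ℕ∞) + 1) M := .of_le (n := ∞) (by norm_cast)
  have : IsManifold I (minSmoothness ℝ 2) M := by simpa using isManifold_two I M
  have : IsManifold I (minSmoothness ℝ 3) M := by
    simpa using IsManifold.of_le (I := I) (M := M) (m := 3) (n := ∞) (by norm_cast)
  ContMDiffAt.mlieBracket_vectorField (m := 1) (n := 2) hX hY (by simp; norm_num)

theorem mdifferentiableAt_of_contMDiffAt_two {E' H' M' : Type*} [NormedAddCommGroup E']
    [NormedSpace ℝ E'] [TopologicalSpace H'] {I' : ModelWithCorners ℝ E' H'} [TopologicalSpace M']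
    [ChartedSpace H' M'] {f : M → M'} (hf : ContMDiffAt I I' 2 f x) :
    MDifferentiableAt I I' f x :=
  hf.mdifferentiableAt (by norm_num)

theorem eventually_mdifferentiableAt {E' H' M' : Type*} [NormedAddCommGroup E']
    [NormedSpace ℝ E'] [TopologicalSpace H'] {I' : ModelWithCorners ℝ E' H'} [TopologicalSpace M']
    [ChartedSpace H' M'] [IsManifold I' 2 M'] {f : M → M'} (hf : ContMDiffAt I I' 2 f x) :
    ∀ᶠ y in 𝓝 x, MDifferentiableAt I I' f y := by
  have : IsManifold I 2 M := isManifold_two I M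
  exact ((contMDiffAt_iff_contMDiffAt_nhds (by norm_num)).1 hf).mono fun y hy ↦
    hy.mdifferentiableAt (by norm_num)

/-- The derivative of a `C^2` function along a `C^2` vector field is `C^1`. -/
theorem contMDiffAt_mvfderiv_apply
    (g : ContMDiffRiemannianMetric I 2 E (TangentSpace I : M → Type _)) {f : M → ℝ}
    (hf : CMDiffAt 2 f x) (hX : CMDiffAt 2 (T% X) x)
    (hT : CMDiffAt 2 (T% T) x) (hT0 : T x ≠ 0) : CMDiffAt 1 (fun y ↦ d% f y (X y)) x := by
  have hTT := contMDiffAt_inner g le_rfl hT hT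
  have hne : g.inner x (T x) (T x) ≠ 0 := (g.pos x _ hT0).ne'
  -- Pairing `[X, fT] = (Xf) T + f [X, T]` with `T` and solving for `Xf` expresses the derivative
  -- through brackets of `C^2` fields, which are known to be `C^1`. The metric is only auxiliary
  -- here.
  have h1 : CMDiffAt 1 (fun y ↦ (g.inner y (mlieBracket I X (f • T) y) (T y)
      - f y * g.inner y (mlieBracket I X T y) (T y)) / g.inner y (T y) (T y)) x := by
    have hT1 : CMDiffAt 1 (T% T) x := hT.of_le (by norm_num)
    refine ContMDiffAt.div₀ (.sub ?_ (.mul (hf.of_le (by norm_num)) ?_))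
      (hTT.of_le (by norm_num)) hne
    · exact contMDiffAt_inner g (by norm_num) (contMDiffAt_mlieBracket hX (hf.smul_section hT)) hT1
    · exact contMDiffAt_inner g (by norm_num) (contMDiffAt_mlieBracket hX hT) hT1
  refine h1.congr_of_eventuallyEq ?_
  have : IsManifold I 2 M := isManifold_two I M
  filter_upwards [eventually_mdifferentiableAt hf, eventually_mdifferentiableAt hT,
    hTT.continuousAt.eventually_ne hne] with y hfy hTy hney
  rw [mlieBracket_smul_right hfy hTy, map_add, map_smul, map_smul]
  simp
  field_simp

end General

end FoliatedSurface

namespace FoliatedSurface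

/-! ### Tensoriality of the curvature -/

section Curvature

variable {E : Type*} [NormedAddCommGroup E] [NormedSpace ℝ E] [FiniteDimensional ℝ E]
  [CompleteSpace E] {H : Type*} [TopologicalSpace H] {I : ModelWithCorners ℝ E H}
  {M : Type*} [TopologicalSpace M] [ChartedSpace H M] [IsManifold I ∞ M]
  {X Y Z : Π x : M, TangentSpace I x} {x : M}

/-- A vector field acts on `C^2` functions as a derivation compatible with the Lie bracket:
`X (Y f) - Y (X f) = [X, Y] f`. -/
theorem mvfderiv_mlieBracket (g : ContMDiffRiemannianMetric I 2 E (TangentSpace I : M → Type _))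
    {f : M → ℝ} (hf : CMDiffAt 2 f x) (hX : CMDiffAt 2 (T% X) x) (hY : CMDiffAt 2 (T% Y) x)
    (hX0 : X x ≠ 0) :
    d% (fun y ↦ d% f y (Y y)) x (X x) - d% (fun y ↦ d% f y (X y)) x (Y x)
      = d% f x (mlieBracket I X Y x) := by
  have : IsManifold I 2 M := isManifold_two I M
  have : IsManifold I (minSmoothness ℝ 3) M := by
    simpa using IsManifold.of_le (I := I) (M := M) (m := 3) (n := ∞) (by norm_cast)
  -- In the Jacobi identity for `X`, `Y`, `fX` the second derivatives of `f` appear as coefficients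
  -- of `X`, which can be compared because `X x ≠ 0`.
  have hjac := leibniz_identity_mlieBracket_apply (U := X) (V := Y) (W := f • X) (by simpa using hX)
    (by simpa using hY) (by simpa using hf.smul_section hX)
  have key : ∀ V : Π x : M, TangentSpace I x,
      mlieBracket I V (f • X) =ᶠ[𝓝 x]
        (fun y ↦ d% f y (V y)) • X + f • mlieBracket I V X := fun V ↦ by
    filter_upwards [eventually_mdifferentiableAt hf, eventually_mdifferentiableAt hX] with y h1 h2
    simp [mlieBracket_smul_right h1 h2]
    rfl
  have hf1 := mdifferentiableAt_of_contMDiffAt_two hf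
  have hX1 := mdifferentiableAt_of_contMDiffAt_two hX
  have hfX := (contMDiffAt_mvfderiv_apply g hf hX hX hX0).mdifferentiableAt one_ne_zero
  have hfY := (contMDiffAt_mvfderiv_apply g hf hY hX hX0).mdifferentiableAt one_ne_zero
  have hYX := (contMDiffAt_mlieBracket hY hX).mdifferentiableAt one_ne_zero
  rw [(Filter.EventuallyEq.refl _ X).mlieBracket_vectorField_eq (key Y),
    (Filter.EventuallyEq.refl _ Y).mlieBracket_vectorField_eq (key X), (key _).self_of_nhds,
    mlieBracket_self, smul_zero, add_zero,
    mlieBracket_add_right (hfY.smul_section hX1) (hf1.smul_section hYX),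
    mlieBracket_smul_right hfY hX1, mlieBracket_smul_right hf1 hYX,
    mlieBracket_smul_right hfX hX1] at hjac
  -- The Jacobi identity for `X`, `Y`, `X` cancels the terms in which `f` is not differentiated.
  have hjac2 := leibniz_identity_mlieBracket_apply (U := X) (V := Y) (W := X) (by simpa using hX)
    (by simpa using hY) (by simpa using hX)
  simp only [mlieBracket_self, mlieBracket_zero_right, Pi.zero_apply, add_zero] at hjac2
  simp only [Pi.add_apply, Pi.smul_apply', mlieBracket_self, Pi.zero_apply, smul_zero, add_zero,
    hjac2] at hjac
  rw [← sub_eq_zero]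
  refine (smul_eq_zero.1 ?_).resolve_right hX0
  refine Eq.trans ?_ (sub_eq_zero.2 hjac)
  module

variable (cov : CovariantDerivative I E (TangentSpace I : M → Type _))

theorem cov_congr (hX : MDiffAt (T% X) x) (hY : MDiffAt (T% Y) x) (h : X =ᶠ[𝓝 x] Y) :
    cov X x = cov Y x :=
  cov.isCovariantDerivativeOnUniv.congr_of_eventuallyEq hX hY Filter.univ_mem h

theorem cov_add (hX : MDiffAt (T% X) x) (hY : MDiffAt (T% Y) x) :
    cov (X + Y) x = cov X x + cov Y x :=
  cov.isCovariantDerivativeOnUniv.add hX hY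

theorem cov_smul {f : M → ℝ} (hf : MDiffAt f x) (hX : MDiffAt (T% X) x) (u : TangentSpace I x) :
    cov (f • X) x u = f x • cov X x u + d% f x u • X x := by
  rw [cov.isCovariantDerivativeOnUniv.leibniz hX hf]
  simp

/-- The curvature `R(X, Y)Z` is tensorial in `X` whenever `∇ Z` is differentiable. -/
theorem curvature_tensorial_left
    (hZ : ∀ X : Π x : M, TangentSpace I x, MDiffAt (T% X) x →
      MDiffAt (T% (fun y ↦ cov Z y (X y))) x) :
    TensorialAt I E (fun X ↦ curvature cov X Y Z x) x where
  smul {f X} hf hX := by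
    have h : (fun y ↦ cov Z y ((f • X) y)) = f • fun y ↦ cov Z y (X y) := by
      ext y; simp
    simp only [curvature, h, cov_smul cov hf (hZ X hX), mlieBracket_smul_left hf hX]
    simp
    module
  add {X X'} hX hX' := by
    have h : (fun y ↦ cov Z y ((X + X') y)) = (fun y ↦ cov Z y (X y)) + fun y ↦ cov Z y (X' y) := by
      ext y; simp
    simp only [curvature, h, cov_add cov (hZ X hX) (hZ X' hX'), mlieBracket_add_left hX hX']
    simp
    module

theorem curvature_swap : curvature cov X Y Z x = -curvature cov Y X Z x := by
  rw [curvature, curvature, mlieBracket_swap_apply, map_neg]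
  module

/-- The curvature `R(X, Y)Z` is tensorial in `Y` whenever `∇ Z` is differentiable. -/
theorem curvature_tensorial_middle
    (hZ : ∀ X : Π x : M, TangentSpace I x, MDiffAt (T% X) x →
      MDiffAt (T% (fun y ↦ cov Z y (X y))) x) :
    TensorialAt I E (fun Y ↦ curvature cov X Y Z x) x where
  smul hf hY := by
    simp only [curvature_swap cov (X := X), (curvature_tensorial_left cov hZ).smul hf hY,
      smul_neg]
  add hY hY' := by
    simp only [curvature_swap cov (X := X), (curvature_tensorial_left cov hZ).add hY hY',
      neg_add]

/-- The curvature differentiates `∇Z`, so `∇Z = ∇Z'` is needed on a whole neighbourhood. Locality of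
a connection is available only at points of differentiability; the `C^2` assumption provides these
near `x`. -/
theorem curvature_congr {Z' : Π x : M, TangentSpace I x} (hZ : CMDiffAt 2 (T% Z) x)
    (hZ' : CMDiffAt 2 (T% Z') x) (hX : MDiffAt (T% (fun y ↦ cov Z y (X y))) x)
    (hY : MDiffAt (T% (fun y ↦ cov Z y (Y y))) x) (h : Z =ᶠ[𝓝 x] Z') :
    curvature cov X Y Z x = curvature cov X Y Z' x := by
  have : IsManifold I 2 M := isManifold_two I M
  have key : ∀ᶠ y in 𝓝 x, cov Z y = cov Z' y := by
    filter_upwards [h.eventuallyEq_nhds, eventually_mdifferentiableAt hZ,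
      eventually_mdifferentiableAt hZ'] with y h1 h2 h3
    exact cov_congr cov h2 h3 h1
  have key' : ∀ V : Π x : M, TangentSpace I x,
      (fun y ↦ cov Z y (V y)) =ᶠ[𝓝 x] fun y ↦ cov Z' y (V y) := fun V ↦ by
    filter_upwards [key] with y hy
    rw [hy]
  have key'' : ∀ V : Π x : M, TangentSpace I x, MDiffAt (T% (fun y ↦ cov Z y (V y))) x →
      MDiffAt (T% (fun y ↦ cov Z' y (V y))) x := fun V hV ↦ by
    refine hV.congr_of_eventuallyEq ?_
    filter_upwards [key' V] with y hy
    simp only [hy]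
  rw [curvature, curvature, key.self_of_nhds, cov_congr cov hX (key'' X hX) (key' X),
    cov_congr cov hY (key'' Y hY) (key' Y)]

theorem curvature_add {Z' : Π x : M, TangentSpace I x} (hZ : CMDiffAt 2 (T% Z) x)
    (hZ' : CMDiffAt 2 (T% Z') x)
    (hZX : MDiffAt (T% (fun y ↦ cov Z y (X y))) x) (hZY : MDiffAt (T% (fun y ↦ cov Z y (Y y))) x)
    (hZX' : MDiffAt (T% (fun y ↦ cov Z' y (X y))) x)
    (hZY' : MDiffAt (T% (fun y ↦ cov Z' y (Y y))) x)
    (hX : MDiffAt (T% (fun y ↦ cov (Z + Z') y (X y))) x)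
    (hY : MDiffAt (T% (fun y ↦ cov (Z + Z') y (Y y))) x) :
    curvature cov X Y (Z + Z') x = curvature cov X Y Z x + curvature cov X Y Z' x := by
  have : IsManifold I 2 M := isManifold_two I M
  have key : ∀ V : Π x : M, TangentSpace I x, (fun y ↦ cov (Z + Z') y (V y)) =ᶠ[𝓝 x]
      (fun y ↦ cov Z y (V y)) + fun y ↦ cov Z' y (V y) := fun V ↦ by
    filter_upwards [eventually_mdifferentiableAt hZ, eventually_mdifferentiableAt hZ'] with y h1 h2
    simp [cov_add cov h1 h2]
    rfl
  rw [curvature, cov_congr cov hX (mdifferentiableAt_add_section hZX hZX') (key X),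
    cov_congr cov hY (mdifferentiableAt_add_section hZY hZY') (key Y), cov_add cov hZX hZX',
    cov_add cov hZY hZY', cov_add cov (mdifferentiableAt_of_contMDiffAt_two hZ)
      (mdifferentiableAt_of_contMDiffAt_two hZ'), curvature, curvature]
  simp
  module

/-- The mixed terms `(Xf) ∇_Y Z` and `(Yf) ∇_X Z` are symmetric in `X`, `Y` and cancel; the second
derivatives of `f` cancel against `([X, Y]f) Z` by `mvfderiv_mlieBracket`, which is where `X x ≠ 0`
enters. -/
theorem curvature_smul (g : ContMDiffRiemannianMetric I 2 E (TangentSpace I : M → Type _))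
    {f : M → ℝ} (hf : CMDiffAt 2 f x) (hZ : CMDiffAt 2 (T% Z) x)
    (hX : CMDiffAt 2 (T% X) x) (hY : CMDiffAt 2 (T% Y) x) (hX0 : X x ≠ 0)
    (hZX : MDiffAt (T% (fun y ↦ cov Z y (X y))) x) (hZY : MDiffAt (T% (fun y ↦ cov Z y (Y y))) x) :
    curvature cov X Y (f • Z) x = f x • curvature cov X Y Z x := by
  have : IsManifold I 2 M := isManifold_two I M
  have hf1 := mdifferentiableAt_of_contMDiffAt_two hf
  have hZ1 := mdifferentiableAt_of_contMDiffAt_two hZ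
  have main : ∀ V : Π x : M, TangentSpace I x, CMDiffAt 2 (T% V) x →
      MDiffAt (T% (fun y ↦ cov Z y (V y))) x → ∀ u : TangentSpace I x,
      cov (fun y ↦ cov (f • Z) y (V y)) x u = f x • cov (fun y ↦ cov Z y (V y)) x u
        + d% f x u • cov Z x (V x) + d% f x (V x) • cov Z x u
        + d% (fun y ↦ d% f y (V y)) x u • Z x := fun V hV hZV u ↦ by
    have hfV := (contMDiffAt_mvfderiv_apply g hf hV hX hX0).mdifferentiableAt one_ne_zero
    have key : (fun y ↦ cov (f • Z) y (V y)) =ᶠ[𝓝 x]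
        (f • fun y ↦ cov Z y (V y)) + (fun y ↦ d% f y (V y)) • Z := by
      filter_upwards [eventually_mdifferentiableAt hf, eventually_mdifferentiableAt hZ] with y h1 h2
      simp [cov_smul cov h1 h2]
      rfl
    have h1 := hf1.smul_section hZV
    have h2 := hfV.smul_section hZ1
    have h3 := mdifferentiableAt_add_section h1 h2
    rw [cov_congr cov (h3.congr_of_eventuallyEq ?_) h3 key, cov_add cov h1 h2, add_apply,
      cov_smul cov hf1 hZV, cov_smul cov hfV hZ1]
    · module
    · filter_upwards [key] with y hy
      rw [hy]
  have hcomm := mvfderiv_mlieBracket g hf hX hY hX0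
  rw [curvature, main X hX hZX, main Y hY hZY, cov_smul cov hf1 hZ1, ← hcomm, curvature]
  module

end Curvature

end FoliatedSurface

namespace FoliatedSurface

/-! ### Local orthonormal frames and their connection coefficients -/

section OrthonormalFrame

variable {E : Type*} [NormedAddCommGroup E] [NormedSpace ℝ E] [FiniteDimensional ℝ E]
  [CompleteSpace E] [Fact (Module.finrank ℝ E = 2)]
  {H : Type*} [TopologicalSpace H] {I : ModelWithCorners ℝ E H}
  {M : Type*} [TopologicalSpace M] [ChartedSpace H M] [IsManifold I ∞ M]
  {g : ContMDiffRiemannianMetric I 2 E (TangentSpace I : M → Type _)}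
  {T N : Π x : M, TangentSpace I x} {x : M}

theorem mvfderiv_congr {f f' : M → ℝ} (h : f =ᶠ[𝓝 x] f') : d% f x = d% f' x := by
  ext u
  simp only [mvfderiv, h.mfderiv_eq]
  rfl

variable (I) in
theorem finrank_tangentSpace (x : M) : Module.finrank ℝ (TangentSpace I x) = 2 :=
  Fact.out (p := Module.finrank ℝ E = 2)

theorem exists_basis_of_orthonormal {t n : TangentSpace I x} (ht : g.inner x t t = 1)
    (hn : g.inner x n n = 1) (htn : g.inner x t n = 0) :
    ∃ B : Module.Basis (Fin 2) ℝ (TangentSpace I x), B 0 = t ∧ B 1 = n := by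
  have hnt : g.inner x n t = 0 := by rw [g.symm, htn]
  have hli : LinearIndependent ℝ ![t, n] := by
    rw [LinearIndependent.pair_iff]
    intro a b hab
    have ha := congrArg (g.inner x t) hab
    have hb := congrArg (g.inner x n) hab
    simp only [map_add, map_smul, map_zero, ht, hn, htn, hnt, smul_eq_mul] at ha hb
    exact ⟨by linarith, by linarith⟩
  exact ⟨basisOfLinearIndependentOfCardEqFinrank hli (by simp [finrank_tangentSpace I x]),
    by simp, by simp⟩

theorem eq_sum_of_orthonormal {t n : TangentSpace I x} (ht : g.inner x t t = 1)
    (hn : g.inner x n n = 1) (htn : g.inner x t n = 0) (v : TangentSpace I x) :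
    v = g.inner x v t • t + g.inner x v n • n := by
  obtain ⟨B, rfl, rfl⟩ := exists_basis_of_orthonormal ht hn htn
  have h := B.sum_repr v
  rw [Fin.sum_univ_two] at h
  have hnt : g.inner x (B 1) (B 0) = 0 := by rw [g.symm, htn]
  have h0 := congrArg (fun w ↦ g.inner x w (B 0)) h
  have h1 := congrArg (fun w ↦ g.inner x w (B 1)) h
  simp only [map_add, map_smul, add_apply, smul_apply, ht, hn, htn, hnt, smul_eq_mul, mul_one,
    mul_zero, add_zero, zero_add] at h0 h1
  rw [← h0, ← h1, h]

theorem trace_of_orthonormal {t n : TangentSpace I x} (ht : g.inner x t t = 1)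
    (hn : g.inner x n n = 1) (htn : g.inner x t n = 0)
    (A : TangentSpace I x →ₗ[ℝ] TangentSpace I x) :
    LinearMap.trace ℝ (TangentSpace I x) A = g.inner x (A t) t + g.inner x (A n) n := by
  have key := eq_sum_of_orthonormal ht hn htn
  obtain ⟨B, rfl, rfl⟩ := exists_basis_of_orthonormal ht hn htn
  have h0 : B.repr (A (B 0)) 0 = g.inner x (A (B 0)) (B 0) := by
    conv_lhs => rw [key (A (B 0))]
    simp
  have h1 : B.repr (A (B 1)) 1 = g.inner x (A (B 1)) (B 1) := by
    conv_lhs => rw [key (A (B 1))]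
    simp
  rw [LinearMap.trace_eq_matrix_trace ℝ B, Matrix.trace_fin_two, LinearMap.toMatrix_apply,
    LinearMap.toMatrix_apply, h0, h1]

/-- There is a tangent vector that is not a multiple of a given one. -/
theorem exists_sub_smul_ne_zero (n : TangentSpace I x) :
    ∃ u : TangentSpace I x, ∀ c : ℝ, u - c • n ≠ 0 := by
  by_contra! h
  have := finrank_le_one n fun u ↦ (h u).imp fun c hc ↦ (sub_eq_zero.1 hc).symm
  rw [finrank_tangentSpace I x] at this
  omega

/-- If `g(Y, Z)` is constant near `x`, then `g(∇_X Y, Z) = -g(Y, ∇_X Z)` at `x`. -/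
theorem inner_leviCivita_add_of_eventually_const
    {X Y Z : Π x : M, TangentSpace I x} (hX : MDiffAt (T% X) x)
    (hY : MDiffAt (T% Y) x) (hZ : MDiffAt (T% Z) x) {c : ℝ}
    (hc : ∀ᶠ y in 𝓝 x, g.inner y (Y y) (Z y) = c) :
    g.inner x (leviCivita g Y x (X x)) (Z x) + g.inner x (Y x) (leviCivita g Z x (X x)) = 0 := by
  rw [← leviCivita_metric g hX hY hZ, mvfderiv_congr (f' := fun _ ↦ c) hc, mvfderiv_const]
  rfl

/-- The vector fields `T`, `N` form an orthonormal frame of class `C^2` near `x`. -/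
structure IsOrthonormalFrameAt (g : ContMDiffRiemannianMetric I 2 E (TangentSpace I : M → Type _))
    (T N : Π x : M, TangentSpace I x) (x : M) :
    Prop where
  left : CMDiffAt 2 (T% T) x
  right : CMDiffAt 2 (T% N) x
  inner_left : ∀ᶠ y in 𝓝 x, g.inner y (T y) (T y) = 1
  inner_right : ∀ᶠ y in 𝓝 x, g.inner y (N y) (N y) = 1
  inner_left_right : ∀ᶠ y in 𝓝 x, g.inner y (T y) (N y) = 0

/-- Gram–Schmidt: extend a vector independent of `N x`, subtract the component along `N`, and
normalise where the result is nonzero. -/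
theorem exists_isOrthonormalFrameAt (hN : CMDiffAt 2 (T% N) x)
    (hNN : ∀ y, g.inner y (N y) (N y) = 1) : ∃ T, IsOrthonormalFrameAt g T N x := by
  obtain ⟨u, hu⟩ := exists_sub_smul_ne_zero (N x)
  let X := FiberBundle.extend E u
  have hX : CMDiffAt 2 (T% X) x := by
    have : IsManifold I (2 + 1) M := .of_le (n := ∞) (by norm_cast)
    exact FiberBundle.contMDiffAt_extend I E u
  let c : M → ℝ := fun y ↦ g.inner y (X y) (N y)
  let Y : Π x : M, TangentSpace I x := X - c • N
  have hY : CMDiffAt 2 (T% Y) x :=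
    hX.sub_section ((contMDiffAt_inner g le_rfl hX hN).smul_section hN)
  have hYx : Y x ≠ 0 := by simpa [Y, X] using hu (c x)
  have hpos : 0 < g.inner x (Y x) (Y x) := g.pos x _ hYx
  have hYY := contMDiffAt_inner g le_rfl hY hY
  have hev : ∀ᶠ y in 𝓝 x, 0 < g.inner y (Y y) (Y y) := hYY.continuousAt.eventually_const_lt hpos
  let f : M → ℝ := fun y ↦ (√(g.inner y (Y y) (Y y)))⁻¹
  have hf : CMDiffAt 2 f x := by
    have h : ContDiffAt ℝ 2 (fun r : ℝ ↦ (√r)⁻¹) (g.inner x (Y x) (Y x)) :=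
      (contDiffAt_id.sqrt hpos.ne').inv (Real.sqrt_ne_zero'.2 hpos)
    exact ContMDiffAt.comp (g := fun r : ℝ ↦ (√r)⁻¹) x h.contMDiffAt hYY
  refine ⟨f • Y, hf.smul_section hY, hN, ?_, .of_forall hNN, .of_forall fun y ↦ ?_⟩
  · filter_upwards [hev] with y hy
    have h := Real.mul_self_sqrt hy.le
    have h' := Real.sqrt_ne_zero'.2 hy
    simp only [Pi.smul_apply', map_smul, smul_apply, smul_eq_mul, f]
    field_simp
    rw [sq, h]
  · simp [Y, c, hNN]

namespace IsOrthonormalFrameAt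


theorem eventually_self (h : IsOrthonormalFrameAt g T N x) :
    ∀ᶠ y in 𝓝 x, IsOrthonormalFrameAt g T N y := by
  have := isManifold_two I M
  filter_upwards [(contMDiffAt_iff_contMDiffAt_nhds (by norm_num)).1 h.left,
    (contMDiffAt_iff_contMDiffAt_nhds (by norm_num)).1 h.right,
    h.inner_left.eventually_nhds, h.inner_right.eventually_nhds,
    h.inner_left_right.eventually_nhds] with y h1 h2 h3 h4 h5
  exact ⟨h1, h2, h3, h4, h5⟩

theorem left_ne_zero (h : IsOrthonormalFrameAt g T N x) : T x ≠ 0 := fun h0 ↦ by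
  simpa [h0] using h.inner_left.self_of_nhds

theorem mdifferentiableAt_left (h : IsOrthonormalFrameAt g T N x) : MDiffAt (T% T) x :=
  mdifferentiableAt_of_contMDiffAt_two h.left

theorem mdifferentiableAt_right (h : IsOrthonormalFrameAt g T N x) : MDiffAt (T% N) x :=
  mdifferentiableAt_of_contMDiffAt_two h.right

end IsOrthonormalFrameAt

/-- The connection coefficient `g(∇_T T, N)` of an orthonormal frame. -/
def coeffLeft (g : ContMDiffRiemannianMetric I 2 E (TangentSpace I : M → Type _))
    (T N : Π x : M, TangentSpace I x) (y : M) : ℝ :=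
  -g.inner y (mlieBracket I T N y) (T y)

/-- The connection coefficient `g(∇_N T, N)` of an orthonormal frame. -/
def coeffRight (g : ContMDiffRiemannianMetric I 2 E (TangentSpace I : M → Type _))
    (T N : Π x : M, TangentSpace I x) (y : M) : ℝ :=
  -g.inner y (mlieBracket I T N y) (N y)

namespace IsOrthonormalFrameAt


/-- Defining the coefficient by a Lie bracket makes its regularity visible without any regularity of
the connection. -/
theorem mdifferentiableAt_coeffLeft (h : IsOrthonormalFrameAt g T N x) :
    MDiffAt (coeffLeft g T N) x :=
  ((contMDiffAt_inner g (by norm_num) (contMDiffAt_mlieBracket h.left h.right)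
    (h.left.of_le (by norm_num))).neg).mdifferentiableAt one_ne_zero

theorem mdifferentiableAt_coeffRight (h : IsOrthonormalFrameAt g T N x) :
    MDiffAt (coeffRight g T N) x :=
  ((contMDiffAt_inner g (by norm_num) (contMDiffAt_mlieBracket h.left h.right)
    (h.right.of_le (by norm_num))).neg).mdifferentiableAt one_ne_zero

theorem eq_sum (h : IsOrthonormalFrameAt g T N x) (v : TangentSpace I x) :
    v = g.inner x v (T x) • T x + g.inner x v (N x) • N x :=
  eq_sum_of_orthonormal h.inner_left.self_of_nhds h.inner_right.self_of_nhds
    h.inner_left_right.self_of_nhds v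

theorem mlieBracket_eq (h : IsOrthonormalFrameAt g T N x) : mlieBracket I T N x
    = -coeffLeft g T N x • T x - coeffRight g T N x • N x := by
  conv_lhs => rw [h.eq_sum (mlieBracket I T N x)]
  simp only [coeffLeft, coeffRight]
  module

end IsOrthonormalFrameAt

end OrthonormalFrame

end FoliatedSurface

namespace FoliatedSurface

/-! ### Covariant derivatives and curvature in an orthonormal frame -/

section FrameEquations

variable {E : Type*} [NormedAddCommGroup E] [NormedSpace ℝ E] [FiniteDimensional ℝ E]
  [CompleteSpace E] [Fact (Module.finrank ℝ E = 2)]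
  {H : Type*} [TopologicalSpace H] {I : ModelWithCorners ℝ E H}
  {M : Type*} [TopologicalSpace M] [ChartedSpace H M] [IsManifold I ∞ M]
  {g : ContMDiffRiemannianMetric I 2 E (TangentSpace I : M → Type _)}
  {T N : Π x : M, TangentSpace I x} {x : M}

namespace IsOrthonormalFrameAt

/-- Metric compatibility with constant inner products makes the connection matrix skew, which leaves
two unknowns; vanishing torsion reads them off from `[T, N]`. -/
theorem leviCivita_eq (h : IsOrthonormalFrameAt g T N x) :
    leviCivita g T x (T x) = coeffLeft g T N x • N x ∧
    leviCivita g T x (N x) = coeffRight g T N x • N x ∧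
    leviCivita g N x (T x) = -coeffLeft g T N x • T x ∧
    leviCivita g N x (N x) = -coeffRight g T N x • T x := by
  have hT := h.mdifferentiableAt_left
  have hN := h.mdifferentiableAt_right
  have tor := leviCivita_torsion g hT hN
  have t1 := congrArg (fun w ↦ g.inner x w (T x)) tor
  have t2 := congrArg (fun w ↦ g.inner x w (N x)) tor
  simp only [map_sub, sub_apply] at t1 t2
  have a1 := inner_leviCivita_add_of_eventually_const hT hT hT h.inner_left
  have a2 := inner_leviCivita_add_of_eventually_const hN hT hT h.inner_left
  have b1 := inner_leviCivita_add_of_eventually_const hT hN hN h.inner_right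
  have b2 := inner_leviCivita_add_of_eventually_const hN hN hN h.inner_right
  have c1 := inner_leviCivita_add_of_eventually_const hT hT hN h.inner_left_right
  have c2 := inner_leviCivita_add_of_eventually_const hN hT hN h.inner_left_right
  simp only [g.symm x (T x) (leviCivita _ _ _ _), g.symm x (N x) (leviCivita _ _ _ _)]
    at a1 a2 b1 b2 c1 c2
  refine ⟨?_, ?_, ?_, ?_⟩
  · rw [h.eq_sum (leviCivita g T x (T x)), coeffLeft]
    have e1 : g.inner x (leviCivita g T x (T x)) (T x) = 0 := by linarith
    have e2 : g.inner x (leviCivita g T x (T x)) (N x)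
      = -g.inner x (mlieBracket I T N x) (T x) := by linarith
    rw [e1, e2]; module
  · rw [h.eq_sum (leviCivita g T x (N x)), coeffRight]
    have e1 : g.inner x (leviCivita g T x (N x)) (T x) = 0 := by linarith
    have e2 : g.inner x (leviCivita g T x (N x)) (N x)
      = -g.inner x (mlieBracket I T N x) (N x) := by linarith
    rw [e1, e2]; module
  · rw [h.eq_sum (leviCivita g N x (T x)), coeffLeft]
    have e1 : g.inner x (leviCivita g N x (T x)) (N x) = 0 := by linarith
    have e2 : g.inner x (leviCivita g N x (T x)) (T x)
      = g.inner x (mlieBracket I T N x) (T x) := by linarith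
    rw [e1, e2]; module
  · rw [h.eq_sum (leviCivita g N x (N x)), coeffRight]
    have e1 : g.inner x (leviCivita g N x (N x)) (N x) = 0 := by linarith
    have e2 : g.inner x (leviCivita g N x (N x)) (T x)
      = g.inner x (mlieBracket I T N x) (N x) := by linarith
    rw [e1, e2]; module

theorem eventually_leviCivita_eq (h : IsOrthonormalFrameAt g T N x) : ∀ᶠ y in 𝓝 x,
    leviCivita g T y (T y) = coeffLeft g T N y • N y ∧
    leviCivita g T y (N y) = coeffRight g T N y • N y ∧
    leviCivita g N y (T y) = -coeffLeft g T N y • T y ∧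
    leviCivita g N y (N y) = -coeffRight g T N y • T y :=
  h.eventually_self.mono fun _ hy ↦ hy.leviCivita_eq

theorem mdifferentiableAt_leviCivita_left_left (h : IsOrthonormalFrameAt g T N x) :
    MDiffAt (T% (fun y ↦ leviCivita g T y (T y))) x := by
  refine (h.mdifferentiableAt_coeffLeft.smul_section
    h.mdifferentiableAt_right).congr_of_eventuallyEq ?_
  filter_upwards [h.eventually_leviCivita_eq] with y hy
  rw [hy.1]; rfl

theorem mdifferentiableAt_leviCivita_left_right (h : IsOrthonormalFrameAt g T N x) :
    MDiffAt (T% (fun y ↦ leviCivita g T y (N y))) x := by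
  refine (h.mdifferentiableAt_coeffRight.smul_section
    h.mdifferentiableAt_right).congr_of_eventuallyEq ?_
  filter_upwards [h.eventually_leviCivita_eq] with y hy
  rw [hy.2.1]; rfl

theorem mdifferentiableAt_leviCivita_right_left (h : IsOrthonormalFrameAt g T N x) :
    MDiffAt (T% (fun y ↦ leviCivita g N y (T y))) x := by
  refine (h.mdifferentiableAt_coeffLeft.neg.smul_section
    h.mdifferentiableAt_left).congr_of_eventuallyEq ?_
  filter_upwards [h.eventually_leviCivita_eq] with y hy
  rw [hy.2.2.1]; rfl

theorem mdifferentiableAt_leviCivita_right_right (h : IsOrthonormalFrameAt g T N x) :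
    MDiffAt (T% (fun y ↦ leviCivita g N y (N y))) x := by
  refine (h.mdifferentiableAt_coeffRight.neg.smul_section
    h.mdifferentiableAt_left).congr_of_eventuallyEq ?_
  filter_upwards [h.eventually_leviCivita_eq] with y hy
  rw [hy.2.2.2]; rfl

/-- A vector field in terms of an orthonormal frame. -/
theorem eventually_eq_sum (h : IsOrthonormalFrameAt g T N x) (Z : Π x : M, TangentSpace I x) :
    ∀ᶠ y in 𝓝 x, Z y = ((fun y ↦ g.inner y (Z y) (T y)) • T
      + (fun y ↦ g.inner y (Z y) (N y)) • N) y :=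
  h.eventually_self.mono fun y hy ↦ hy.eq_sum (Z y)

/-- `∇_X Z` is differentiable if `X` and the covariant derivatives of `Z` along the frame are. -/
theorem mdifferentiableAt_leviCivita_of_frame (h : IsOrthonormalFrameAt g T N x)
    {X Z : Π x : M, TangentSpace I x} (hX : MDiffAt (T% X) x)
    (hT : MDiffAt (T% (fun y ↦ leviCivita g Z y (T y))) x)
    (hN : MDiffAt (T% (fun y ↦ leviCivita g Z y (N y))) x) :
    MDiffAt (T% (fun y ↦ leviCivita g Z y (X y))) x := by
  refine (mdifferentiableAt_add_section
    ((mdiff_inner g hX h.mdifferentiableAt_left).smul_section hT)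
    ((mdiff_inner g hX h.mdifferentiableAt_right).smul_section hN)).congr_of_eventuallyEq ?_
  filter_upwards [h.eventually_eq_sum X] with y hy
  conv_lhs => rw [hy]
  simp

/-- `∇_X Z` is differentiable if `X` is differentiable and `Z` is of class `C^2`. -/
theorem mdifferentiableAt_leviCivita (h : IsOrthonormalFrameAt g T N x)
    {X Z : Π x : M, TangentSpace I x} (hX : MDiffAt (T% X) x) (hZ : CMDiffAt 2 (T% Z) x) :
    MDiffAt (T% (fun y ↦ leviCivita g Z y (X y))) x := by
  have : IsManifold I 2 M := isManifold_two I M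
  have hr := contMDiffAt_inner g le_rfl hZ h.left
  have hs := contMDiffAt_inner g le_rfl hZ h.right
  have hZ' := (hr.smul_section h.left).add_section (hs.smul_section h.right)
  -- Apply the product rule to `Z = rT + sN`. Differentiability of `V(r)` and `V(s)` is obtained for
  -- `C^2` directions `V`, so only `V = T` and `V = N` are treated this way; a general `X` is then
  -- expanded in the frame.
  have aux : ∀ V : Π x : M, TangentSpace I x, CMDiffAt 2 (T% V) x →
      MDiffAt (T% (fun y ↦ leviCivita g T y (V y))) x →
      MDiffAt (T% (fun y ↦ leviCivita g N y (V y))) x →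
      MDiffAt (T% (fun y ↦ leviCivita g Z y (V y))) x := fun V hV h1 h2 ↦ by
    have d := fun {f : M → ℝ} (hf : CMDiffAt 2 f x) ↦
      (contMDiffAt_mvfderiv_apply g hf hV h.left h.left_ne_zero).mdifferentiableAt one_ne_zero
    refine (mdifferentiableAt_add_section (mdifferentiableAt_add_section
      ((mdifferentiableAt_of_contMDiffAt_two hr).smul_section h1)
      ((d hr).smul_section h.mdifferentiableAt_left)) (mdifferentiableAt_add_section
      ((mdifferentiableAt_of_contMDiffAt_two hs).smul_section h2)
      ((d hs).smul_section h.mdifferentiableAt_right))).congr_of_eventuallyEq ?_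
    filter_upwards [(h.eventually_eq_sum Z).eventually_nhds, h.eventually_self,
      eventually_mdifferentiableAt hZ, eventually_mdifferentiableAt hZ',
      eventually_mdifferentiableAt hr, eventually_mdifferentiableAt hs] with y e1 e2 e3 e4 e5 e6
    rw [cov_congr (leviCivita g) e3 e4 e1,
      cov_add _ (e5.smul_section e2.mdifferentiableAt_left)
        (e6.smul_section e2.mdifferentiableAt_right), add_apply,
      cov_smul _ e5 e2.mdifferentiableAt_left, cov_smul _ e6 e2.mdifferentiableAt_right]
    rfl
  exact h.mdifferentiableAt_leviCivita_of_frame hX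
    (aux T h.left h.mdifferentiableAt_leviCivita_left_left h.mdifferentiableAt_leviCivita_right_left)
    (aux N h.right h.mdifferentiableAt_leviCivita_left_right
      h.mdifferentiableAt_leviCivita_right_right)

end IsOrthonormalFrameAt

/-- The curvature function of an orthonormal frame. -/
def frameCurvature (g : ContMDiffRiemannianMetric I 2 E (TangentSpace I : M → Type _))
    (T N : Π x : M, TangentSpace I x) (x : M) : ℝ :=
  d% (coeffLeft g T N) x (N x) - d% (coeffRight g T N) x (T x)
    - coeffLeft g T N x ^ 2 - coeffRight g T N x ^ 2

namespace IsOrthonormalFrameAt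

/-- The `N`-components `-αβ` of `∇_T(-βT)` and `∇_N(-αT)` cancel, and `∇_[T,N] N` contributes the
two squares. -/
theorem curvature_right (h : IsOrthonormalFrameAt g T N x) :
    curvature (leviCivita g) T N N x = frameCurvature g T N x • T x := by
  have hα := h.mdifferentiableAt_coeffLeft
  have hβ := h.mdifferentiableAt_coeffRight
  obtain ⟨e1, e2, e3, e4⟩ := h.leviCivita_eq
  rw [curvature, cov_congr _ (X := fun y ↦ leviCivita g N y (N y))
      (Y := (-coeffRight g T N) • T) h.mdifferentiableAt_leviCivita_right_right
      (hβ.neg.smul_section h.mdifferentiableAt_left)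
      (h.eventually_leviCivita_eq.mono fun y hy ↦ hy.2.2.2),
    cov_congr _ (X := fun y ↦ leviCivita g N y (T y))
      (Y := (-coeffLeft g T N) • T) h.mdifferentiableAt_leviCivita_right_left
      (hα.neg.smul_section h.mdifferentiableAt_left)
      (h.eventually_leviCivita_eq.mono fun y hy ↦ hy.2.2.1),
    cov_smul _ hβ.neg h.mdifferentiableAt_left, cov_smul _ hα.neg h.mdifferentiableAt_left,
    mvfderiv_neg, mvfderiv_neg, h.mlieBracket_eq, map_sub, map_smul, map_smul, e1, e2, e3, e4,
    frameCurvature]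
  simp
  module

theorem curvature_left (h : IsOrthonormalFrameAt g T N x) :
    curvature (leviCivita g) T N T x = -frameCurvature g T N x • N x := by
  have hα := h.mdifferentiableAt_coeffLeft
  have hβ := h.mdifferentiableAt_coeffRight
  obtain ⟨e1, e2, e3, e4⟩ := h.leviCivita_eq
  rw [curvature, cov_congr _ (X := fun y ↦ leviCivita g T y (N y))
      (Y := (coeffRight g T N) • N) h.mdifferentiableAt_leviCivita_left_right
      (hβ.smul_section h.mdifferentiableAt_right)
      (h.eventually_leviCivita_eq.mono fun y hy ↦ hy.2.1),
    cov_congr _ (X := fun y ↦ leviCivita g T y (T y))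
      (Y := (coeffLeft g T N) • N) h.mdifferentiableAt_leviCivita_left_left
      (hα.smul_section h.mdifferentiableAt_right)
      (h.eventually_leviCivita_eq.mono fun y hy ↦ hy.1),
    cov_smul _ hβ h.mdifferentiableAt_right, cov_smul _ hα h.mdifferentiableAt_right,
    h.mlieBracket_eq, map_sub, map_smul, map_smul, e1, e2, e3, e4,
    frameCurvature]
  simp
  module

/-- The curvature `R(T, N)Z` of a `C^2` vector field `Z`. -/
theorem curvature_frame (h : IsOrthonormalFrameAt g T N x) {Z : Π x : M, TangentSpace I x}
    (hZ : CMDiffAt 2 (T% Z) x) :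
    curvature (leviCivita g) T N Z x = (frameCurvature g T N x * g.inner x (Z x) (N x)) • T x
      - (frameCurvature g T N x * g.inner x (Z x) (T x)) • N x := by
  have hr := contMDiffAt_inner g le_rfl hZ h.left
  have hs := contMDiffAt_inner g le_rfl hZ h.right
  have hrT := hr.smul_section h.left
  have hsN := hs.smul_section h.right
  have d := fun {Z : Π x : M, TangentSpace I x} (hZ : CMDiffAt 2 (T% Z) x) ↦
    And.intro (h.mdifferentiableAt_leviCivita h.mdifferentiableAt_left hZ)
      (h.mdifferentiableAt_leviCivita h.mdifferentiableAt_right hZ)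
  rw [curvature_congr _ hZ (hrT.add_section hsN) (d hZ).1 (d hZ).2 (h.eventually_eq_sum Z),
    curvature_add _ hrT hsN (d hrT).1 (d hrT).2 (d hsN).1 (d hsN).2 (d (hrT.add_section hsN)).1
      (d (hrT.add_section hsN)).2,
    curvature_smul _ g hr h.left h.left h.right h.left_ne_zero (d h.left).1 (d h.left).2,
    curvature_smul _ g hs h.right h.left h.right h.left_ne_zero (d h.right).1 (d h.right).2,
    h.curvature_left, h.curvature_right]
  module

/-- The curvature `R(X, Y)Z` in terms of an orthonormal frame. -/
theorem curvature_eq (h : IsOrthonormalFrameAt g T N x) {X Y Z : Π x : M, TangentSpace I x}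
    (hX : MDiffAt (T% X) x) (hY : MDiffAt (T% Y) x) (hZ : CMDiffAt 2 (T% Z) x) :
    curvature (leviCivita g) X Y Z x =
      (g.inner x (X x) (T x) * g.inner x (Y x) (N x)
        - g.inner x (X x) (N x) * g.inner x (Y x) (T x)) • curvature (leviCivita g) T N Z x := by
  have hZ' := fun (X : Π x : M, TangentSpace I x) (hX : MDiffAt (T% X) x) ↦
    h.mdifferentiableAt_leviCivita hX hZ
  have tl := fun (Y : Π x : M, TangentSpace I x) ↦
    curvature_tensorial_left (leviCivita g) (Y := Y) hZ'
  have tm := fun (X : Π x : M, TangentSpace I x) ↦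
    curvature_tensorial_middle (leviCivita g) (X := X) hZ'
  have hT := h.mdifferentiableAt_left
  have hN := h.mdifferentiableAt_right
  have expand : ∀ V : Π x : M, TangentSpace I x, MDiffAt (T% V) x →
      MDiffAt (T% ((fun y ↦ g.inner y (V y) (T y)) • T)) x ∧
      MDiffAt (T% ((fun y ↦ g.inner y (V y) (N y)) • N)) x := fun V hV ↦
    ⟨(mdiff_inner g hV hT).smul_section hT, (mdiff_inner g hV hN).smul_section hN⟩
  have self : ∀ V : Π x : M, TangentSpace I x, curvature (leviCivita g) V V Z x = 0 := fun V ↦ by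
    simp [curvature]
  have left : ∀ V : Π x : M, TangentSpace I x, curvature (leviCivita g) X V Z x
      = g.inner x (X x) (T x) • curvature (leviCivita g) T V Z x
        + g.inner x (X x) (N x) • curvature (leviCivita g) N V Z x := fun V ↦ by
    rw [(tl V).local hX (mdifferentiableAt_add_section (expand X hX).1 (expand X hX).2)
      (h.eventually_eq_sum X), (tl V).add (expand X hX).1 (expand X hX).2,
      (tl V).smul (mdiff_inner g hX hT) hT, (tl V).smul (mdiff_inner g hX hN) hN]
  have right : ∀ V : Π x : M, TangentSpace I x, curvature (leviCivita g) V Y Z x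
      = g.inner x (Y x) (T x) • curvature (leviCivita g) V T Z x
        + g.inner x (Y x) (N x) • curvature (leviCivita g) V N Z x := fun V ↦ by
    rw [(tm V).local hY (mdifferentiableAt_add_section (expand Y hY).1 (expand Y hY).2)
      (h.eventually_eq_sum Y), (tm V).add (expand Y hY).1 (expand Y hY).2,
      (tm V).smul (mdiff_inner g hY hT) hT, (tm V).smul (mdiff_inner g hY hN) hN]
  -- Bilinear and alternating in two dimensions: only the determinant of the coordinates survives.
  rw [left, right, right, self, self, curvature_swap (leviCivita g) (X := N) (Y := T)]
  module

/-- The sectional curvature of the tangent plane of a surface. -/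
theorem sectionalCurvature_eq (h : IsOrthonormalFrameAt g T N x) {u v : TangentSpace I x}
    (huv : LinearIndependent ℝ ![u, v]) :
    sectionalCurvature g x u v = frameCurvature g T N x := by
  have : IsManifold I (2 + 1) M := .of_le (n := ∞) (by norm_cast)
  have hTT := h.inner_left.self_of_nhds
  have hNN := h.inner_right.self_of_nhds
  have hTN := h.inner_left_right.self_of_nhds
  have hNT : g.inner x (N x) (T x) = 0 := by rw [g.symm, hTN]
  rw [sectionalCurvature, h.curvature_eq (FiberBundle.mdifferentiableAt_extend I E u)
    (FiberBundle.mdifferentiableAt_extend I E v) (FiberBundle.contMDiffAt_extend I E v),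
    h.curvature_frame (FiberBundle.contMDiffAt_extend I E v)]
  simp only [FiberBundle.extend_apply_self]
  have hu := h.eq_sum u
  have hv := h.eq_sum v
  set p := g.inner x u (T x)
  set q := g.inner x u (N x)
  set r := g.inner x v (T x)
  set s := g.inner x v (N x)
  -- If the determinant vanished, then `su - qv = 0` and `ru - pv = 0`, so independence would force
  -- `p = q = 0`, that is `u = 0`.
  have hdet : p * s - q * r ≠ 0 := fun h0 ↦ by
    have hp := LinearIndependent.pair_iff.1 huv s (-q) (by
      rw [hu, hv]
      refine Eq.trans (b := (p * s - q * r) • T x) (by module) (by rw [h0, zero_smul]))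
    have hp' := LinearIndependent.pair_iff.1 huv r (-p) (by
      rw [hu, hv]
      refine Eq.trans (b := (-(p * s - q * r)) • N x) (by module) (by rw [h0, neg_zero, zero_smul]))
    rw [neg_eq_zero] at hp hp'
    rw [hp.2, hp'.2] at hu
    refine huv.ne_zero 0 ?_
    simpa using hu
  rw [hu, hv]
  simp only [map_add, map_sub, map_smul, add_apply, sub_apply, smul_apply, hTT, hNN, hTN, hNT,
    smul_eq_mul]
  rw [div_eq_iff]
  · ring
  · intro h0
    -- Lagrange's identity: the Gram determinant of `u`, `v` is the square of `ps - qr`.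
    exact pow_ne_zero 2 hdet (by linear_combination h0)

end IsOrthonormalFrameAt

end FrameEquations

end FoliatedSurface

namespace FoliatedSurface

/-! ### Geodesic curvature and `div(∇_N N)` in the frame; integrating factor in time -/

section StaticIdentity

variable {E : Type*} [NormedAddCommGroup E] [NormedSpace ℝ E] [FiniteDimensional ℝ E]
  [CompleteSpace E] [Fact (Module.finrank ℝ E = 2)]
  {H : Type*} [TopologicalSpace H] {I : ModelWithCorners ℝ E H}
  {M : Type*} [TopologicalSpace M] [ChartedSpace H M] [IsManifold I ∞ M]
  {g : ContMDiffRiemannianMetric I 2 E (TangentSpace I : M → Type _)}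
  {T N : Π x : M, TangentSpace I x} {x : M}

namespace IsOrthonormalFrameAt

theorem trace_weingarten (h : IsOrthonormalFrameAt g T N x) :
    LinearMap.trace ℝ (TangentSpace I x) (weingarten g N x) = coeffLeft g T N x := by
  have hTT := h.inner_left.self_of_nhds
  have hNN := h.inner_right.self_of_nhds
  have hTN := h.inner_left_right.self_of_nhds
  have hNT : g.inner x (N x) (T x) = 0 := by rw [g.symm, hTN]
  obtain ⟨-, -, e3, -⟩ := h.leviCivita_eq
  rw [trace_of_orthonormal hTT hNN hTN]
  simp [weingarten, tangential, hTT, hNN, hNT, e3]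

/-- As `∇_N N = -βT`, the diagonal entries are `g(∇_T(-βT), T) = -T(β)` and `g(∇_N(-βT), N) = -β²`.
-/
theorem divergence_leviCivita_right (h : IsOrthonormalFrameAt g T N x) :
    divergence g (fun y ↦ leviCivita g N y (N y)) x
      = -d% (coeffRight g T N) x (T x) - coeffRight g T N x ^ 2 := by
  have hTT := h.inner_left.self_of_nhds
  have hNN := h.inner_right.self_of_nhds
  have hTN := h.inner_left_right.self_of_nhds
  have hNT : g.inner x (N x) (T x) = 0 := by rw [g.symm, hTN]
  have hβ := h.mdifferentiableAt_coeffRight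
  obtain ⟨e1, e2, -, -⟩ := h.leviCivita_eq
  rw [divergence, trace_of_orthonormal hTT hNN hTN]
  simp only [ContinuousLinearMap.coe_coe]
  rw [cov_congr _ (X := fun y ↦ leviCivita g N y (N y))
      (Y := (-coeffRight g T N) • T) h.mdifferentiableAt_leviCivita_right_right
      (hβ.neg.smul_section h.mdifferentiableAt_left)
      (h.eventually_leviCivita_eq.mono fun y hy ↦ hy.2.2.2),
    cov_smul _ hβ.neg h.mdifferentiableAt_left, cov_smul _ hβ.neg h.mdifferentiableAt_left,
    mvfderiv_neg, e1, e2]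
  simp [hTT, hNN, hTN, hNT]
  ring

end IsOrthonormalFrameAt

end StaticIdentity

/-- A function whose logarithmic derivative is the continuous function `-φ`. -/
theorem exp_integral_mul_eq {f φ : ℝ → ℝ} {t ε : ℝ} (hφ : ContinuousOn φ (Ico 0 ε))
    (hf : ∀ s ∈ Ico 0 ε, HasDerivWithinAt f (-φ s * f s) (Ico 0 ε) s) (ht : t ∈ Ico 0 ε) :
    Real.exp (∫ s in (0 : ℝ)..t, φ s) * f t = f 0 := by
  have hsub : Icc 0 t ⊆ Ico 0 ε := Icc_subset_Ico_right ht.2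
  -- Extending `φ` by its endpoint values makes it continuous on `ℝ`, so its primitive has a
  -- two-sided derivative at `0` and `t` too.
  let φ' : ℝ → ℝ := IccExtend ht.1 fun s : Icc 0 t ↦ φ s
  have hφ' : Continuous φ' := (continuousOn_iff_continuous_domRestrict.1 (hφ.mono hsub)).Icc_extend'
  have heq : ∀ s ∈ Icc 0 t, φ' s = φ s := fun s hs ↦ by
    simp [φ', IccExtend_of_mem ht.1 _ hs]
  have hint : ∫ s in (0 : ℝ)..t, φ s = ∫ s in (0 : ℝ)..t, φ' s :=
    intervalIntegral.integral_congr fun s hs ↦ (heq s (by rwa [uIcc_of_le ht.1] at hs)).symm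
  let G : ℝ → ℝ := fun r ↦ Real.exp (∫ s in (0 : ℝ)..r, φ' s) * f r
  have hG : ∀ s ∈ Icc 0 t, HasDerivWithinAt G 0 (Icc 0 t) s := fun s hs ↦ by
    have h1 : HasDerivAt (fun r ↦ ∫ s in (0 : ℝ)..r, φ' s) (φ' s) s :=
      intervalIntegral.integral_hasDerivAt_right (hφ'.intervalIntegrable _ _)
        (hφ'.stronglyMeasurableAtFilter _ _) hφ'.continuousAt
    refine (h1.exp.hasDerivWithinAt.mul ((hf s (hsub hs)).mono hsub)).congr_deriv ?_
    rw [heq s hs]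
    ring
  have := constant_of_derivWithin_zero (f := G) (a := 0) (b := t)
    (fun s hs ↦ (hG s hs).differentiableWithinAt)
    (fun s hs ↦ (hG s (Ico_subset_Icc_self hs)).derivWithin
      (uniqueDiffOn_Icc (hs.1.trans_lt hs.2) s (Ico_subset_Icc_self hs))) t ⟨ht.1, le_rfl⟩
  simpa [G, hint] using this

section Surface

variable {M : Type*} [TopologicalSpace M] [ChartedSpace (EuclideanSpace ℝ (Fin 2)) M]
  [IsManifold (𝓡 2) ∞ M] {N : Π x : M, TangentSpace (𝓡 2) x}

instance fact_finrank_euclideanSpace_two : Fact (Module.finrank ℝ (EuclideanSpace ℝ (Fin 2)) = 2) :=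
  ⟨finrank_euclideanSpace_fin⟩

/-! ### The curvature identity for a single metric -/

section Static

variable {g : Metric M} {T : Π x : M, TangentSpace (𝓡 2) x} {x : M}

theorem IsOrthonormalFrameAt.gaussianCurvature_eq (h : IsOrthonormalFrameAt g T N x) :
    gaussianCurvature g x = frameCurvature g T N x := by
  refine h.sectionalCurvature_eq ?_
  change LinearIndependent ℝ (![EuclideanSpace.single 0 1, EuclideanSpace.single 1 1] :
    Fin 2 → EuclideanSpace ℝ (Fin 2))
  rw [LinearIndependent.pair_iff]
  intro a b hab
  have h0 := congrArg (fun w : EuclideanSpace ℝ (Fin 2) ↦ w 0) hab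
  have h1 := congrArg (fun w : EuclideanSpace ℝ (Fin 2) ↦ w 1) hab
  exact ⟨by simpa using h0, by simpa using h1⟩

theorem IsOrthonormalFrameAt.leafCurvature_eventuallyEq (h : IsOrthonormalFrameAt g T N x) :
    leafCurvature N g =ᶠ[𝓝 x] coeffLeft g T N :=
  h.eventually_self.mono fun _ hy ↦ hy.trace_weingarten

theorem mdifferentiableAt_leafCurvature
    (hN : ContMDiff (𝓡 2) (𝓡 2).tangent 2 (fun x ↦ (⟨x, N x⟩ : TangentBundle (𝓡 2) M)))
    (hNN : ∀ y, g.inner y (N y) (N y) = 1) (x : M) :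
    MDifferentiableAt (𝓡 2) 𝓘(ℝ, ℝ) (leafCurvature N g) x := by
  obtain ⟨T, h⟩ := exists_isOrthonormalFrameAt (hN x) hNN
  exact h.mdifferentiableAt_coeffLeft.congr_of_eventuallyEq h.leafCurvature_eventuallyEq

theorem mdifferentiableAt_leviCivita_self
    (hN : ContMDiff (𝓡 2) (𝓡 2).tangent 2 (fun x ↦ (⟨x, N x⟩ : TangentBundle (𝓡 2) M)))
    (hNN : ∀ y, g.inner y (N y) (N y) = 1) (x : M) :
    MDifferentiableAt (𝓡 2) (𝓡 2).tangent
      (fun x ↦ (⟨x, leviCivita g N x (N x)⟩ : TangentBundle (𝓡 2) M)) x := by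
  obtain ⟨T, h⟩ := exists_isOrthonormalFrameAt (hN x) hNN
  exact h.mdifferentiableAt_leviCivita_right_right

/-- The Gaussian curvature in terms of a unit vector field `N` and the geodesic curvature of the
curves orthogonal to `N`: `K = div(∇_N N) + N(λ) - λ^2`. -/
theorem gaussianCurvature_eq_divergence
    (hN : ContMDiff (𝓡 2) (𝓡 2).tangent 2 (fun x ↦ (⟨x, N x⟩ : TangentBundle (𝓡 2) M)))
    (hNN : ∀ y, g.inner y (N y) (N y) = 1) (x : M) :
    gaussianCurvature g x = divergence g (fun y ↦ leviCivita g N y (N y)) x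
      + along N (leafCurvature N g) x - leafCurvature N g x ^ 2 := by
  obtain ⟨T, h⟩ := exists_isOrthonormalFrameAt (hN x) hNN
  rw [h.gaussianCurvature_eq, h.divergence_leviCivita_right, along,
    mvfderiv_congr h.leafCurvature_eventuallyEq, h.leafCurvature_eventuallyEq.self_of_nhds,
    frameCurvature]
  ring

/-- The covector `g(∇_N N, ·)` of a `g`-unit vector field `N` in terms of the covector field
`g(N, ·)`. -/
theorem inner_leviCivita_self {Z : Π x : M, TangentSpace (𝓡 2) x}
    (hN : MDifferentiableAt (𝓡 2) (𝓡 2).tangent (fun x ↦ (⟨x, N x⟩ : TangentBundle (𝓡 2) M)) x)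
    (hZ : MDifferentiableAt (𝓡 2) (𝓡 2).tangent (fun x ↦ (⟨x, Z x⟩ : TangentBundle (𝓡 2) M)) x)
    (hNN : ∀ y, g.inner y (N y) (N y) = 1) :
    g.inner x (leviCivita g N x (N x)) (Z x)
      = mvfderiv (𝓡 2) (fun y ↦ g.inner y (N y) (Z y)) x (N x)
        - g.inner x (N x) (mlieBracket (𝓡 2) N Z x) := by
  have h := inner_leviCivita g hN hN hZ
  -- With both first arguments equal to `N`, the terms `Z(g(N, N))` and `[N, N]` drop out and the
  -- metric enters only through `g(N, ·)`.
  simp only [koszul, hNN, mlieBracket_self, mvfderiv_const] at h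
  rw [g.symm x (N x) (mlieBracket (𝓡 2) N Z x)]
  simp at h
  linarith

end Static

/-! ### Evolution along the flow -/

namespace IsFlow

variable {F : Foliation M} {ψ : ℝ → ℝ} {ε : ℝ} {g : ℝ → Metric M} {t : ℝ}

theorem inner_self (hg : IsFlow F N ψ ε g) (ht : t ∈ Ico 0 ε) (x : M) :
    (g t).inner x (N x) (N x) = 1 :=
  (hg.adapted t ht x).1

theorem truncated_eq (hg : IsFlow F N ψ ε g) (ht : t ∈ Ico 0 ε) (x : M)
    (u v : TangentSpace (𝓡 2) x) :
    truncated (g t) N x u v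
      = (g t).inner x u v - (g t).inner x (N x) u * (g t).inner x (N x) v := by
  simp [truncated, tangential, hg.inner_self ht, (g t).symm x u (N x)]
  ring

/-- The covector field `g_t(N, ·)` does not depend on time. -/
theorem inner_normal_eq (hg : IsFlow F N ψ ε g) (ht : t ∈ Ico 0 ε) (x : M)
    (u : TangentSpace (𝓡 2) x) : (g t).inner x (N x) u = (g 0).inner x (N x) u := by
  have h0 : (0 : ℝ) ∈ Ico 0 ε := ⟨le_rfl, ht.1.trans_lt ht.2⟩
  refine (convex_Ico 0 ε).is_const_of_fderivWithin_eq_zero (𝕜 := ℝ)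
    (f := fun s ↦ (g s).inner x (N x) u)
    (fun s hs ↦ (hg.flow s hs x _ _).differentiableWithinAt) (fun s hs ↦ ?_) ht h0
  have h := hg.flow s hs x (N x) u
  rw [hg.truncated_eq hs, hg.inner_self hs, one_mul, sub_self, mul_zero] at h
  have h' := h.hasFDerivWithinAt.fderivWithin (uniqueDiffOn_Ico 0 ε s hs)
  rw [h']
  ext
  simp

/-- The speed of the flow is continuous in time. -/
theorem continuousOn_along (hg : IsFlow F N ψ ε g) (x : M) :
    ContinuousOn (fun s ↦ along N (fun y ↦ ψ (leafCurvature N (g s) y)) x) (Ico 0 ε) := by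
  -- For `u` off the line of `N`, `ĝ_s(u, u)` never vanishes, so the flow equation can be solved for
  -- the speed as a quotient of functions continuous in time.
  obtain ⟨u, hu⟩ := exists_sub_smul_ne_zero (N x)
  have hpos : ∀ s ∈ Ico 0 ε, truncated (g s) N x u u ≠ 0 := fun s hs ↦ by
    have h := (g s).pos x _ (hu ((g s).inner x (N x) u))
    simpa [truncated, tangential] using h.ne'
  have hd : ContinuousOn (derivWithin (fun s ↦ (g s).inner x u u) (Ico 0 ε)) (Ico 0 ε) :=
    (hg.contDiffOn x u u).continuousOn_derivWithin (uniqueDiffOn_Ico 0 ε) le_rfl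
  have hc : ContinuousOn (fun s ↦ truncated (g s) N x u u) (Ico 0 ε) := by
    refine ContinuousOn.congr (f := fun s ↦ (g s).inner x u u
      - (g s).inner x (N x) u * (g s).inner x (N x) u)
      ((hg.contDiffOn x u u).continuousOn.sub ((hg.contDiffOn x (N x) u).continuousOn.mul
        (hg.contDiffOn x (N x) u).continuousOn)) fun s hs ↦ hg.truncated_eq hs x u u
  refine (hd.neg.div hc hpos).congr fun s hs ↦ ?_
  have h := (hg.flow s hs x u u).derivWithin (uniqueDiffOn_Ico 0 ε s hs)
  have := hpos s hs
  rw [Pi.div_apply, Pi.neg_apply, h]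
  field_simp

theorem intervalIntegrable_along (hg : IsFlow F N ψ ε g) (ht : t ∈ Ico 0 ε) (x : M) :
    IntervalIntegrable (fun s ↦ along N (fun y ↦ ψ (leafCurvature N (g s) y)) x)
      MeasureTheory.volume 0 t := by
  refine ContinuousOn.intervalIntegrable ((hg.continuousOn_along x).mono ?_)
  rw [uIcc_of_le ht.1]
  exact Icc_subset_Ico_right ht.2

/-- The truncated metric evolves by the factor `exp(-∫ N(ψ(λ)))`. -/
theorem exp_integral_mul_truncated (hg : IsFlow F N ψ ε g) (ht : t ∈ Ico 0 ε) (x : M)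
    (u v : TangentSpace (𝓡 2) x) :
    Real.exp (∫ s in (0 : ℝ)..t, along N (fun y ↦ ψ (leafCurvature N (g s) y)) x)
      * truncated (g t) N x u v = truncated (g 0) N x u v := by
  refine exp_integral_mul_eq (f := fun s ↦ truncated (g s) N x u v) (hg.continuousOn_along x)
    (fun s hs ↦ ?_) ht
  -- By `inner_normal_eq`, `ĝ_s` and `g_s` differ by a term constant in time, so the flow equation
  -- becomes a linear equation for `ĝ_s(u, v)` alone.
  refine ((hg.flow s hs x u v).sub_const
    ((g 0).inner x (N x) u * (g 0).inner x (N x) v)).congr (fun r hr ↦ ?_) ?_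
  · rw [hg.truncated_eq hr, hg.inner_normal_eq hr, hg.inner_normal_eq hr]
  · rw [hg.truncated_eq hs, hg.inner_normal_eq hs, hg.inner_normal_eq hs]

/-- The curvature vector field `∇_N N` of the integral curves of `N` evolves by the factor
`exp(∫ N(ψ(λ)))`. -/
theorem exp_integral_smul_leviCivita (hg : IsFlow F N ψ ε g)
    (hN : ContMDiff (𝓡 2) (𝓡 2).tangent 2 (fun x ↦ (⟨x, N x⟩ : TangentBundle (𝓡 2) M)))
    (ht : t ∈ Ico 0 ε) (x : M) :
    Real.exp (∫ s in (0 : ℝ)..t, along N (fun y ↦ ψ (leafCurvature N (g s) y)) x)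
      • leviCivita (g 0) N x (N x) = leviCivita (g t) N x (N x) := by
  have h0 : (0 : ℝ) ∈ Ico 0 ε := ⟨le_rfl, ht.1.trans_lt ht.2⟩
  have hNx := mdifferentiableAt_of_contMDiffAt_two (hN x)
  -- Orthogonality to `N` lets the full metrics be replaced by the truncated ones, whose scaling is
  -- known.
  have hperp : (g 0).inner x (N x) (leviCivita (g 0) N x (N x)) = 0 := by
    have h := inner_leviCivita_self hNx hNx (hg.inner_self h0)
    rw [(g 0).symm]
    simp only [hg.inner_self h0, mvfderiv_const, mlieBracket_self] at h
    simpa using h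
  refine inner_left_injective (g t) fun w ↦ ?_
  have hw := FiberBundle.mdifferentiableAt_extend (I := 𝓡 2) (F := EuclideanSpace ℝ (Fin 2)) w
  have ht' := inner_leviCivita_self hNx hw (hg.inner_self ht)
  have h0' := inner_leviCivita_self hNx hw (hg.inner_self h0)
  have key := hg.exp_integral_mul_truncated ht x (leviCivita (g 0) N x (N x)) w
  -- The right-hand sides of `ht'` and `h0'` now coincide: the dual covector of `∇_N N` is the same
  -- at times `t` and `0`.
  simp only [hg.inner_normal_eq ht] at ht'
  rw [hg.truncated_eq ht, hg.truncated_eq h0, hg.inner_normal_eq ht, hperp, zero_mul,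
    zero_mul, sub_zero, sub_zero] at key
  rw [← h0'] at ht'
  simp only [FiberBundle.extend_apply_self] at ht'
  rw [ht', map_smul, smul_apply, smul_eq_mul, key]

end IsFlow

end Surface

end FoliatedSurface

end

theorem mainTheorem12 {M : Type*} [TopologicalSpace M] [T2Space M]
    [ChartedSpace (EuclideanSpace ℝ (Fin 2)) M] [IsManifold (𝓡 2) ∞ M]
    (F : FoliatedSurface.Foliation M) (N : Π x : M, TangentSpace (𝓡 2) x)
    (hN : ContMDiff (𝓡 2) (𝓡 2).tangent 2 (fun x ↦ (⟨x, N x⟩ : TangentBundle (𝓡 2) M)))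
    (ψ : ℝ → ℝ) (hψ : ContDiff ℝ 3 ψ) (ε : ℝ) (g : ℝ → FoliatedSurface.Metric M)
    (hg : FoliatedSurface.IsFlow F N ψ ε g) (t : ℝ) (ht : t ∈ Set.Ico 0 ε) :
    let lam : ℝ → M → ℝ := fun s ↦ FoliatedSurface.leafCurvature N (g s)
    let W : Π x : M, TangentSpace (𝓡 2) x := fun x ↦
      Real.exp (∫ ξ in (0 : ℝ)..t, FoliatedSurface.along N (fun y ↦ ψ (lam ξ y)) x) •
        FoliatedSurface.leviCivita (g 0) N x (N x)
    (∀ x, IntervalIntegrable (fun ξ ↦ FoliatedSurface.along N (fun y ↦ ψ (lam ξ y)) x)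
        MeasureTheory.volume 0 t) ∧
      MDifferentiable (𝓡 2) 𝓘(ℝ, ℝ) (lam t) ∧
      MDifferentiable (𝓡 2) (𝓡 2).tangent (fun x ↦ (⟨x, W x⟩ : TangentBundle (𝓡 2) M)) ∧
      ∀ x, FoliatedSurface.gaussianCurvature (g t) x =
        FoliatedSurface.divergence (g t) W x + FoliatedSurface.along N (lam t) x - lam t x ^ 2 := by
  intro lam W
  -- This also yields the differentiability of `W`, with no need to differentiate the exponential
  -- factor in space.
  have hW : W = fun x ↦ FoliatedSurface.leviCivita (g t) N x (N x) :=
    funext fun x ↦ hg.exp_integral_smul_leviCivita hN ht x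
  refine ⟨fun x ↦ hg.intervalIntegrable_along ht x,
    fun x ↦ FoliatedSurface.mdifferentiableAt_leafCurvature hN (hg.inner_self ht) x, ?_, ?_⟩
  · rw [hW]
    exact fun x ↦ FoliatedSurface.mdifferentiableAt_leviCivita_self hN (hg.inner_self ht) x
  · rw [hW]
    exact fun x ↦ FoliatedSurface.gaussianCurvature_eq_divergence hN (hg.inner_self ht) x
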